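/- Let $\mathbb{D}$ be the open unit disc in $\mathbb{C}$, let $1 \le p < \infty$, let $\varphi, \psi$ be analytic functions on $\mathbb{D}$ with $\varphi(\mathbb{D}) \subset \mathbb{D}$, and let $W_{\varphi,\psi} f(z) = \psi(z) f(\varphi(z))$ for $f$ analytic on $\mathbb{D}$ and $z \in \mathbb{D}$. Let $H^p$ be the Hardy space of all analytic functions $f$ on $\mathbb{D}$ with $$\|f\|_{H^p}^p = \sup_{0<r<1} \frac{1}{2\pi}\int_0^{2\pi} |f(re^{i\theta})|^p \, d\theta < \infty,$$ let $S^p$ be the space of all analytic functions $f$ on $\mathbb{D}$ with $f' \in H^p$, with the norm $\|f\|_{S^p} = |f(0)| + \|f'\|_{H^p}$, and let $S_2^p$ be the space of all analytic functions $f$ on $\mathbb{D}$ with $f'' \in H^p$, with the norm $\|f\|_{S_2^p} = |f(0)| + |f'(0)| + \|f''\|_{H^p}$. Let $S$ be either of the spaces $S_2^p$ and $S^p$. Then $W_{\varphi,\psi}$ is a bounded operator from $S$ into $H^p$ (that is, it maps $S$ into $H^p$, and there is a finite constant $C$ with $\|W_{\varphi,\psi} f\|_{H^p} \le C \|f\|_S$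 for all $f \in S$) if and only if $\psi \in H^p$. -/

import Mathlib

open scoped ENNReal NNReal

/-- The open unit disc `𝔻` of the complex plane.  A function on `𝔻` is represented by a function
`ℂ → ℂ`, of which only the values on `𝔻` play a role in the definitions below. -/
def unitDisc : Set ℂ := Metric.ball 0 1

/-- `H(𝔻)`: the functions that are analytic (equivalently, complex differentiable) on `𝔻`. -/
def analyticOnDisc : Set (ℂ → ℂ) := {f | DifferentiableOn ℂ f unitDisc}

/-- The integral mean `M_r(f, p) = (1 / 2π) ∫_0^{2π} |f (r e^{iθ})| ^ p dθ`. -/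
noncomputable def integralMean (p : ℝ) (f : ℂ → ℂ) (r : ℝ) : ℝ :=
  (2 * Real.pi)⁻¹ * ∫ θ in (0 : ℝ)..(2 * Real.pi), ‖f (r * Complex.exp (θ * Complex.I))‖ ^ p

/-- The Hardy norm `(sup_{0 < r < 1} M_r(f, p)) ^ (1 / p)` of an analytic function on `𝔻`, with
the value `∞` when the supremum is infinite. -/
noncomputable def hardyNorm (p : ℝ) (f : ℂ → ℂ) : ℝ≥0∞ :=
  (⨆ r ∈ Set.Ioo (0 : ℝ) 1, ENNReal.ofReal (integralMean p f r)) ^ (1 / p)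

/-- The Hardy space `H^p`. -/
def hardySpace (p : ℝ) : Set (ℂ → ℂ) :=
  {f | f ∈ analyticOnDisc ∧ hardyNorm p f < ∞}

/-- The space `S^p`: the analytic functions on `𝔻` with derivative in `H^p`. -/
def derivHardySpace (p : ℝ) : Set (ℂ → ℂ) :=
  {f | f ∈ analyticOnDisc ∧ deriv f ∈ hardySpace p}

/-- The norm `‖f‖ = |f(0)| + ‖f'‖_{H^p}` of `S^p`. -/
noncomputable def derivHardyNorm (p : ℝ) (f : ℂ → ℂ) : ℝ≥0∞ :=
  ‖f 0‖ₑ + hardyNorm p (deriv f)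

/-- The space `S_2^p`: the analytic functions on `𝔻` with second derivative in `H^p`. -/
def secondDerivHardySpace (p : ℝ) : Set (ℂ → ℂ) :=
  {f | f ∈ analyticOnDisc ∧ deriv (deriv f) ∈ hardySpace p}

/-- The norm `‖f‖ = |f(0)| + |f'(0)| + ‖f''‖_{H^p}` of `S_2^p`. -/
noncomputable def secondDerivHardyNorm (p : ℝ) (f : ℂ → ℂ) : ℝ≥0∞ :=
  ‖f 0‖ₑ + ‖deriv f 0‖ₑ + hardyNorm p (deriv (deriv f))

/-- The weighted composition operator `W_{φ, ψ} f (z) = ψ(z) f(φ(z))`. -/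
def weightedComp (φ ψ : ℂ → ℂ) (f : ℂ → ℂ) : ℂ → ℂ :=
  fun z => ψ z * f (φ z)

/-- A (linear) operator `T` is bounded from the space `X` with norm `NX` into the space `Y` with
norm `NY`: it maps `X` into `Y`, and `‖T f‖_Y ≤ C ‖f‖_X` on `X` for some finite constant `C`. -/
def IsBoundedBetween (X : Set (ℂ → ℂ)) (NX : (ℂ → ℂ) → ℝ≥0∞)
    (Y : Set (ℂ → ℂ)) (NY : (ℂ → ℂ) → ℝ≥0∞) (T : (ℂ → ℂ) → (ℂ → ℂ)) : Prop :=
  (∀ f ∈ X, T f ∈ Y) ∧ ∃ C : ℝ≥0, ∀ f ∈ X, NY (T f) ≤ C * NX f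

/-! Necessity is the test function 1, which lies in both spaces and is sent to ψ. Sufficiency rests
on the continuous embedding of both spaces into the bounded functions: then f ∘ φ is bounded by a
multiple of the norm of f, and multiplying ψ by it keeps the product in H^p (`hardyNorm_mul_le`).

For S^p, the means of |f'| of order 1 are controlled by those of order p, so f maps all circles |z|
= r < 1 to curves of uniformly bounded length. Since f(0) is the average of f over such a circle, f
stays within that length of f(0). For S_2^p, the same applied to f' bounds f', and the mean value
inequality then bounds f. -/

lemma circleMap_mem_unitDisc {r : ℝ} (hr : r ∈ Set.Ioo (0 : ℝ) 1) (θ : ℝ) :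
    circleMap 0 r θ ∈ unitDisc := by
  simp [unitDisc, abs_of_pos hr.1, hr.2]

lemma integralMean_eq_circleMap (p : ℝ) (f : ℂ → ℂ) (r : ℝ) :
    integralMean p f r = (2 * Real.pi)⁻¹ * ∫ θ in (0 : ℝ)..(2 * Real.pi),
      ‖f (circleMap 0 r θ)‖ ^ p := by
  simp [integralMean, circleMap]

lemma continuous_comp_circleMap {f : ℂ → ℂ} (hf : f ∈ analyticOnDisc) {r : ℝ}
    (hr : r ∈ Set.Ioo (0 : ℝ) 1) : Continuous fun θ => f (circleMap 0 r θ) :=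
  ContinuousOn.comp_continuous (DifferentiableOn.continuousOn hf) (continuous_circleMap 0 r)
    (circleMap_mem_unitDisc hr)

lemma differentiableAt_of_mem_analyticOnDisc {f : ℂ → ℂ} (hf : f ∈ analyticOnDisc) {z : ℂ}
    (hz : z ∈ unitDisc) : DifferentiableAt ℂ f z :=
  DifferentiableOn.differentiableAt hf (Metric.isOpen_ball.mem_nhds hz)

lemma deriv_mem_analyticOnDisc {f : ℂ → ℂ} (hf : f ∈ analyticOnDisc) :
    deriv f ∈ analyticOnDisc :=
  DifferentiableOn.deriv hf Metric.isOpen_ball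

/-- The integral means of a function are bounded by the `p`-th power of any bound of its Hardy
norm. -/
lemma integralMean_le_of_hardyNorm_le {p : ℝ} (hp : 1 ≤ p) {f : ℂ → ℂ} {t : ℝ} (ht : 0 < t)
    (h : hardyNorm p f ≤ ENNReal.ofReal t) {r : ℝ} (hr : r ∈ Set.Ioo (0 : ℝ) 1) :
    integralMean p f r ≤ t ^ p := by
  have hp0 : 0 < p := by linarith
  rw [hardyNorm, one_div, ENNReal.rpow_inv_le_iff hp0, ENNReal.ofReal_rpow_of_pos ht] at h
  exact (ENNReal.ofReal_le_ofReal_iff (by positivity)).1 ((le_iSup₂ r hr).trans h)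

/-- The arc-length mean over a circle is controlled by the Hardy norm. -/
lemma integral_norm_circleMap_le {p : ℝ} (hp : 1 ≤ p) {g : ℂ → ℂ} (hg : g ∈ analyticOnDisc)
    {t : ℝ} (ht : 0 < t) (h : hardyNorm p g ≤ ENNReal.ofReal t) {r : ℝ}
    (hr : r ∈ Set.Ioo (0 : ℝ) 1) :
    ∫ θ in (0 : ℝ)..(2 * Real.pi), ‖g (circleMap 0 r θ)‖ ≤ 4 * Real.pi * t := by
  have hc := (continuous_comp_circleMap hg hr).norm
  have hcp : Continuous fun θ => ‖g (circleMap 0 r θ)‖ ^ p :=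
    hc.rpow_const fun _ => Or.inr (by linarith)
  have hM := integralMean_le_of_hardyNorm_le hp ht h hr
  rw [integralMean_eq_circleMap, inv_mul_le_iff₀ (by positivity)] at hM
  -- This pointwise bound x ≤ t + t (x/t)^p replaces Hölder's inequality. Each of the two terms
  -- integrates to at most 2πt, whence 4πt.
  have hle (x : ℝ) (hx : 0 ≤ x) : x ≤ t + t * (t ^ p)⁻¹ * x ^ p := by
    have hsplit : t * (t ^ p)⁻¹ * x ^ p = t * (x / t) ^ p := by
      rw [Real.div_rpow hx ht.le]; ring
    rw [hsplit]
    rcases le_total x t with hxt | hxt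
    · have : 0 ≤ t * (x / t) ^ p := by positivity
      linarith
    · have h1 : x / t ≤ (x / t) ^ p := Real.self_le_rpow_of_one_le ((one_le_div ht).2 hxt) hp
      have h2 := mul_le_mul_of_nonneg_left h1 ht.le
      rw [mul_div_cancel₀ _ ht.ne'] at h2
      linarith
  calc ∫ θ in (0 : ℝ)..(2 * Real.pi), ‖g (circleMap 0 r θ)‖
      ≤ ∫ θ in (0 : ℝ)..(2 * Real.pi),
          (t + t * (t ^ p)⁻¹ * ‖g (circleMap 0 r θ)‖ ^ p) :=
        intervalIntegral.integral_mono_on Real.two_pi_pos.le (hc.intervalIntegrable _ _)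
          ((continuous_const.add (continuous_const.mul hcp)).intervalIntegrable _ _)
          fun θ _ => hle _ (norm_nonneg _)
    _ = 2 * Real.pi * t + t * (t ^ p)⁻¹ *
          ∫ θ in (0 : ℝ)..(2 * Real.pi), ‖g (circleMap 0 r θ)‖ ^ p := by
        rw [intervalIntegral.integral_add (by simp)
          (Continuous.intervalIntegrable (by fun_prop) _ _),
          intervalIntegral.integral_const_mul]
        simp
    _ ≤ 2 * Real.pi * t + t * (t ^ p)⁻¹ * (2 * Real.pi * t ^ p) := by gcongr
    _ = 4 * Real.pi * t := by
        have : t ^ p ≠ 0 := by positivity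
        field_simp
        ring

/-- Two values of `f` on a circle differ by at most the length of the image of the circle. -/
lemma norm_sub_le_integral_norm_deriv {f : ℂ → ℂ} (hf : f ∈ analyticOnDisc) {r : ℝ}
    (hr : r ∈ Set.Ioo (0 : ℝ) 1) {a b : ℝ} (ha : a ∈ Set.Icc 0 (2 * Real.pi))
    (hb : b ∈ Set.Icc 0 (2 * Real.pi)) :
    ‖f (circleMap 0 r b) - f (circleMap 0 r a)‖ ≤
      ∫ θ in (0 : ℝ)..(2 * Real.pi), ‖deriv f (circleMap 0 r θ)‖ := by
  wlog hab : a ≤ b generalizing a b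
  · rw [norm_sub_rev]
    exact this hb ha (le_of_not_ge hab)
  have hc := continuous_comp_circleMap (deriv_mem_analyticOnDisc hf) hr
  have hder (θ : ℝ) : HasDerivAt (fun θ => f (circleMap 0 r θ))
      (deriv f (circleMap 0 r θ) * (circleMap 0 r θ * Complex.I)) θ :=
    (differentiableAt_of_mem_analyticOnDisc hf
      (circleMap_mem_unitDisc hr θ)).hasDerivAt.comp θ (hasDerivAt_circleMap 0 r θ)
  have hc' : Continuous fun θ => deriv f (circleMap 0 r θ) * (circleMap 0 r θ * Complex.I) :=
    hc.mul ((continuous_circleMap 0 r).mul continuous_const)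
  rw [← intervalIntegral.integral_eq_sub_of_hasDerivAt (fun θ _ => hder θ)
    (hc'.intervalIntegrable a b)]
  calc _ ≤ ∫ θ in a..b, ‖deriv f (circleMap 0 r θ) * (circleMap 0 r θ * Complex.I)‖ :=
        intervalIntegral.norm_integral_le_integral_norm hab
    _ ≤ ∫ θ in a..b, ‖deriv f (circleMap 0 r θ)‖ :=
        intervalIntegral.integral_mono_on hab (hc'.norm.intervalIntegrable _ _)
          (hc.norm.intervalIntegrable _ _) fun θ _ => by
            simpa [abs_of_pos hr.1] using
              mul_le_of_le_one_right (norm_nonneg (deriv f (circleMap 0 r θ))) hr.2.le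
    _ ≤ _ := intervalIntegral.integral_mono_interval ha.1 hab hb.2
        (Filter.Eventually.of_forall fun _ => norm_nonneg _) (hc.norm.intervalIntegrable _ _)

/-- By the mean value property, f(z) - f(0) is the average of f(z) - f(w) over |w| = |z|. Here z and
w lie on one circle, so circular means of |f'| suffice and no integral along a radius is needed. -/
lemma norm_sub_zero_le_of_integral_norm_deriv_le {f : ℂ → ℂ} (hf : f ∈ analyticOnDisc) {K : ℝ}
    (hK : ∀ r ∈ Set.Ioo (0 : ℝ) 1,
      ∫ θ in (0 : ℝ)..(2 * Real.pi), ‖deriv f (circleMap 0 r θ)‖ ≤ K)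
    {z : ℂ} (hz : z ∈ unitDisc) : ‖f z - f 0‖ ≤ K := by
  -- At the origin the circle degenerates. The claim is then 0 ≤ K, which any radius in (0, 1)
  -- yields.
  rcases eq_or_ne z 0 with rfl | hz0
  · have h := norm_sub_le_integral_norm_deriv hf (r := 1 / 2) (by norm_num)
      (a := 0) (b := 0) (by simp [Real.pi_pos.le]) (by simp [Real.pi_pos.le])
    simpa using h.trans (hK _ (by norm_num))
  have hr : ‖z‖ ∈ Set.Ioo (0 : ℝ) 1 := ⟨norm_pos_iff.2 hz0, by simpa [unitDisc] using hz⟩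
  obtain ⟨b, hb, hbz⟩ : z ∈ circleMap 0 ‖z‖ '' Set.Ioc 0 (2 * Real.pi) := by
    rw [image_circleMap_Ioc]
    simp
  have hmean : Real.circleAverage f 0 ‖z‖ = f 0 := by
    refine (DifferentiableOn.mono hf ?_ : DifferentiableOn ℂ f _).diffContOnCl.circleAverage
    rw [abs_norm, closure_ball _ hr.1.ne']
    exact Metric.closedBall_subset_ball hr.2
  have hc := continuous_comp_circleMap hf hr
  have hsub : f z - f 0 = Real.circleAverage (fun w => f z - f w) 0 ‖z‖ := by
    rw [Real.circleAverage_fun_sub, hmean, Real.circleAverage_const]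
    · exact circleIntegrable_const _ _ _
    · exact hc.intervalIntegrable _ _
  rw [hsub, Real.circleAverage, norm_smul, Real.norm_of_nonneg (by positivity),
    inv_mul_le_iff₀ (by positivity)]
  refine (intervalIntegral.norm_integral_le_of_norm_le_const (C := K) fun θ hθ => ?_).trans_eq ?_
  · rw [Set.uIoc_of_le Real.two_pi_pos.le] at hθ
    have h := (norm_sub_le_integral_norm_deriv hf hr ⟨hθ.1.le, hθ.2⟩ ⟨hb.1.le, hb.2⟩).trans (hK _ hr)
    rwa [hbz] at h
  · rw [sub_zero, abs_of_pos Real.two_pi_pos, mul_comm]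

/-- Functions with derivative in `H^p` are bounded on the disc. -/
lemma norm_sub_zero_le_hardyNorm_deriv {p : ℝ} (hp : 1 ≤ p) {f : ℂ → ℂ}
    (hf : f ∈ derivHardySpace p) {z : ℂ} (hz : z ∈ unitDisc) :
    ‖f z - f 0‖ ≤ 16 * (hardyNorm p (deriv f)).toReal := by
  set n := (hardyNorm p (deriv f)).toReal
  refine le_of_forall_pos_le_add fun ε hε => ?_
  have hn : 0 ≤ n := ENNReal.toReal_nonneg
  -- The integral estimate needs a positive bound, but n may vanish. Since 4π < 16, the shift by
  -- ε/16 costs at most ε.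
  have ht : 0 < n + ε / 16 := by positivity
  have hle : hardyNorm p (deriv f) ≤ ENNReal.ofReal (n + ε / 16) := by
    rw [← ENNReal.ofReal_toReal hf.2.2.ne]
    exact ENNReal.ofReal_le_ofReal (by simp only [n]; linarith)
  have h := norm_sub_zero_le_of_integral_norm_deriv_le hf.1
    (fun r hr => integral_norm_circleMap_le hp hf.2.1 ht hle hr) hz
  nlinarith [Real.pi_lt_four]

lemma enorm_le_derivHardyNorm {p : ℝ} (hp : 1 ≤ p) {f : ℂ → ℂ}
    (hf : f ∈ derivHardySpace p) {z : ℂ} (hz : z ∈ unitDisc) :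
    ‖f z‖ₑ ≤ 16 * derivHardyNorm p f := by
  have h : ‖f z‖ ≤ 16 * (‖f 0‖ + (hardyNorm p (deriv f)).toReal) := by
    have h1 := norm_sub_zero_le_hardyNorm_deriv hp hf hz
    have h2 := norm_le_norm_sub_add (f z) (f 0)
    linarith [norm_nonneg (f 0)]
  have h' := ENNReal.ofReal_le_ofReal h
  rwa [ENNReal.ofReal_mul (by norm_num), ENNReal.ofReal_add (norm_nonneg _) ENNReal.toReal_nonneg,
    ENNReal.ofReal_toReal hf.2.2.ne, ofReal_norm, ofReal_norm, ENNReal.ofReal_ofNat] at h'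

/-- Since f' lies in S^p, it is bounded, so f is Lipschitz on the convex disc, whose points are
within 1 of the origin. -/
lemma enorm_le_secondDerivHardyNorm {p : ℝ} (hp : 1 ≤ p) {f : ℂ → ℂ}
    (hf : f ∈ secondDerivHardySpace p) {z : ℂ} (hz : z ∈ unitDisc) :
    ‖f z‖ₑ ≤ 16 * secondDerivHardyNorm p f := by
  set n := (hardyNorm p (deriv (deriv f))).toReal
  have hf' : deriv f ∈ derivHardySpace p := ⟨deriv_mem_analyticOnDisc hf.1, hf.2⟩
  have hbound : ∀ w ∈ unitDisc, ‖deriv f w‖ ≤ ‖deriv f 0‖ + 16 * n := fun w hw => by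
    have h1 := norm_sub_zero_le_hardyNorm_deriv hp hf' hw
    have h2 := norm_le_norm_sub_add (deriv f w) (deriv f 0)
    linarith
  have hn : 0 ≤ n := ENNReal.toReal_nonneg
  have h : ‖f z‖ ≤ 16 * (‖f 0‖ + ‖deriv f 0‖ + n) := by
    have h1 := Convex.norm_image_sub_le_of_norm_deriv_le
      (fun w hw => differentiableAt_of_mem_analyticOnDisc hf.1 hw) hbound
      (convex_ball (0 : ℂ) 1) (Metric.mem_ball_self one_pos) hz
    have hz1 : ‖z - 0‖ ≤ 1 := by
      rw [sub_zero]; exact (mem_ball_zero_iff.1 hz).le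
    have h2 := norm_le_norm_sub_add (f z) (f 0)
    have h3 := mul_le_of_le_one_right (a := ‖deriv f 0‖ + 16 * n) (by positivity) hz1
    linarith [norm_nonneg (f 0), norm_nonneg (deriv f 0)]
  have h' := ENNReal.ofReal_le_ofReal h
  rwa [ENNReal.ofReal_mul (by norm_num), ENNReal.ofReal_add (by positivity) hn,
    ENNReal.ofReal_add (norm_nonneg _) (norm_nonneg _),
    ENNReal.ofReal_toReal hf.2.2.ne, ofReal_norm, ofReal_norm, ofReal_norm,
    ENNReal.ofReal_ofNat] at h'

/-- Multiplication by a function bounded by `M` multiplies the Hardy norm by at most `M`. -/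
lemma hardyNorm_mul_le {p : ℝ} (hp : 1 ≤ p) {g h : ℂ → ℂ} (hg : g ∈ analyticOnDisc)
    (hh : h ∈ analyticOnDisc) {M : ℝ≥0} (hM : ∀ z ∈ unitDisc, ‖h z‖ ≤ M) :
    hardyNorm p (fun z => g z * h z) ≤ M * hardyNorm p g := by
  have hp0 : 0 < p := by linarith
  rw [hardyNorm, one_div, ENNReal.rpow_inv_le_iff hp0, ENNReal.mul_rpow_of_nonneg _ _ hp0.le, hardyNorm,
    ← ENNReal.rpow_mul, one_div, inv_mul_cancel₀ hp0.ne', ENNReal.rpow_one]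
  refine iSup₂_le fun r hr => ?_
  have hcp {k : ℂ → ℂ} (hk : k ∈ analyticOnDisc) :
      Continuous fun θ => ‖k (circleMap 0 r θ)‖ ^ p :=
    (continuous_comp_circleMap hk hr).norm.rpow_const fun _ => Or.inr hp0.le
  have hmean : integralMean p (fun z => g z * h z) r ≤ (M : ℝ) ^ p * integralMean p g r := by
    rw [integralMean_eq_circleMap, integralMean_eq_circleMap, mul_left_comm,
      ← intervalIntegral.integral_const_mul ((M : ℝ) ^ p)]
    gcongr
    refine intervalIntegral.integral_mono_on Real.two_pi_pos.le
      ((hcp (DifferentiableOn.mul hg hh)).intervalIntegrable _ _)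
      ((continuous_const.mul (hcp hg)).intervalIntegrable _ _) fun θ _ => ?_
    rw [norm_mul, Real.mul_rpow (norm_nonneg _) (norm_nonneg _), mul_comm]
    gcongr
    exact hM _ (circleMap_mem_unitDisc hr θ)
  calc ENNReal.ofReal (integralMean p (fun z => g z * h z) r)
      ≤ ENNReal.ofReal ((M : ℝ) ^ p * integralMean p g r) := ENNReal.ofReal_le_ofReal hmean
    _ = (M : ℝ≥0∞) ^ p * ENNReal.ofReal (integralMean p g r) := by
        rw [ENNReal.ofReal_mul (by positivity),
          ← ENNReal.ofReal_rpow_of_nonneg M.coe_nonneg hp0.le, ENNReal.ofReal_coe_nnreal]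
    _ ≤ _ := by
        gcongr
        exact le_iSup₂ (f := fun r (_ : r ∈ Set.Ioo (0 : ℝ) 1) =>
          ENNReal.ofReal (integralMean p g r)) r hr

/-- If `X` embeds boundedly into `H^∞`, a weight in `H^p` gives a bounded operator into `H^p`. -/
lemma isBoundedBetween_weightedComp {p : ℝ} (hp : 1 ≤ p) {φ ψ : ℂ → ℂ}
    (hφ : φ ∈ analyticOnDisc) (hφ_maps : Set.MapsTo φ unitDisc unitDisc)
    (hψ : ψ ∈ hardySpace p) {X : Set (ℂ → ℂ)} {N : (ℂ → ℂ) → ℝ≥0∞}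
    (hX : X ⊆ analyticOnDisc) (hfin : ∀ f ∈ X, N f < ∞) {K : ℝ≥0}
    (hN : ∀ f ∈ X, ∀ z ∈ unitDisc, ‖f z‖ₑ ≤ K * N f) :
    IsBoundedBetween X N (hardySpace p) (hardyNorm p) (weightedComp φ ψ) := by
  have han (f) (hf : f ∈ X) : (fun z => f (φ z)) ∈ analyticOnDisc :=
    DifferentiableOn.comp (hX hf) hφ hφ_maps
  have hle (f) (hf : f ∈ X) :
      hardyNorm p (weightedComp φ ψ f) ≤ K * N f * hardyNorm p ψ := by
    -- Finiteness of N f turns the bound on f ∘ φ into a real constant, as the multiplication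
    -- estimate requires.
    have hcoe : ((K * (N f).toNNReal : ℝ≥0) : ℝ≥0∞) = K * N f := by
      rw [ENNReal.coe_mul, ENNReal.coe_toNNReal (hfin f hf).ne]
    rw [← hcoe]
    refine hardyNorm_mul_le hp hψ.1 (han f hf) fun z hz => ?_
    have h := hN f hf _ (hφ_maps hz)
    rw [← hcoe, enorm_eq_nnnorm, ENNReal.coe_le_coe] at h
    exact_mod_cast h
  refine ⟨fun f hf => ⟨DifferentiableOn.mul hψ.1 (han f hf), (hle f hf).trans_lt ?_⟩,
    K * (hardyNorm p ψ).toNNReal, fun f hf => (hle f hf).trans_eq ?_⟩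
  · exact ENNReal.mul_lt_top (ENNReal.mul_lt_top ENNReal.coe_lt_top (hfin f hf)) hψ.2
  · rw [ENNReal.coe_mul, ENNReal.coe_toNNReal hψ.2.ne, mul_right_comm]

lemma zero_mem_hardySpace {p : ℝ} (hp : 1 ≤ p) : (fun _ => 0 : ℂ → ℂ) ∈ hardySpace p := by
  have hp0 : 0 < p := by linarith
  refine ⟨differentiableOn_const 0, ?_⟩
  simp [hardyNorm, integralMean, Real.zero_rpow hp0.ne', hp0]

/-- Only the mapping property is used, not the norm inequality. -/
lemma mem_hardySpace_of_isBoundedBetween {p : ℝ} {φ ψ : ℂ → ℂ} {X : Set (ℂ → ℂ)}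
    {N : (ℂ → ℂ) → ℝ≥0∞} (h1 : (fun _ => 1) ∈ X)
    (h : IsBoundedBetween X N (hardySpace p) (hardyNorm p) (weightedComp φ ψ)) :
    ψ ∈ hardySpace p := by
  have hone : weightedComp φ ψ (fun _ => 1) = ψ := funext fun z => mul_one (ψ z)
  exact hone ▸ h.1 _ h1

theorem lemma2p2 (p : ℝ) (hp : 1 ≤ p) (φ ψ : ℂ → ℂ)
    (hφ : φ ∈ analyticOnDisc) (hφ_maps : Set.MapsTo φ unitDisc unitDisc)
    (hψ : ψ ∈ analyticOnDisc) :
    (IsBoundedBetween (secondDerivHardySpace p) (secondDerivHardyNorm p)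
        (hardySpace p) (hardyNorm p) (weightedComp φ ψ) ↔ ψ ∈ hardySpace p) ∧
    (IsBoundedBetween (derivHardySpace p) (derivHardyNorm p)
        (hardySpace p) (hardyNorm p) (weightedComp φ ψ) ↔ ψ ∈ hardySpace p) := by
  have h0 := zero_mem_hardySpace hp
  refine ⟨⟨mem_hardySpace_of_isBoundedBetween ⟨differentiableOn_const 1, by simpa using h0⟩,
    fun h => isBoundedBetween_weightedComp hp hφ hφ_maps h (fun f hf => hf.1) (fun f hf => ?_)
      (K := 16) fun f hf z hz => by simpa using enorm_le_secondDerivHardyNorm hp hf hz⟩,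
    ⟨mem_hardySpace_of_isBoundedBetween ⟨differentiableOn_const 1, by simpa using h0⟩,
    fun h => isBoundedBetween_weightedComp hp hφ hφ_maps h (fun f hf => hf.1) (fun f hf => ?_)
      (K := 16) fun f hf z hz => by simpa using enorm_le_derivHardyNorm hp hf hz⟩⟩
  · exact ENNReal.add_lt_top.2 ⟨ENNReal.add_lt_top.2 ⟨enorm_lt_top, enorm_lt_top⟩, hf.2.2⟩
  · exact ENNReal.add_lt_top.2 ⟨enorm_lt_top, hf.2.2⟩
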